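/- Let $X$ and $Y$ be topological spaces, let $\Lambda$ be a real Hausdorff topological vector space, and let $y_0\in Y$. Let $\varphi:Y\to[0,+\infty[$ be a lower semicontinuous function with $\varphi^{-1}(0)=\{y_0\}$ such that $\inf_{Y\setminus V}\varphi>0$ for each neighbourhood $V$ of $y_0$ (with the convention $\inf\emptyset=+\infty$). Let $\Psi:X\times\Lambda\to Y$ be such that, for each $x\in X$, the function $\Psi(x,\cdot)$ is continuous, injective and open and takes the value $y_0$ at a (necessarily unique) point $\lambda_x\in\Lambda$, and such that the function $x\mapsto\lambda_x$ is not constant. Let $J:X\to\mathbf R$ be a function whose set $M_J$ of global minima is non-empty, and put $$\theta(\varphi,\Psi,J)=\inf\left\{\frac{J(x)-J(u)}{\varphi(\Psi(x,\lambda_u))} : (u,x)\in M_J\times X,\ \lambda_x\neq\lambda_u\right\}.$$ Assume that $\varphi(\Psi(x,\cdot))$ is convex on $\Lambda$ for each $x\in X$, and let $\mu>\theta(\varphi,\Psi,J)$ be a real number. Let $\mathcal N$ be a filtering cover of $X$, that is, a family of non-empty subsets of $X$ whose union is $X$ and such that for all $A_1,A_2\in\mathcal N$ there is $A_3\in\mathcal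 N$ with $A_1\cup A_2\subseteq A_3$. Assume that, for each $A\in\mathcal N$ and each $\lambda\in\operatorname{conv}(\{\lambda_x : x\in X\})$, the restriction to $A$ of the function $x\mapsto J(x)-\mu\varphi(\Psi(x,\lambda))$ is lower semicontinuous and inf-compact, i.e. its sublevel sets $\{x\in A : J(x)-\mu\varphi(\Psi(x,\lambda))\le r\}$, $r\in\mathbf R$, are compact. Then there exist $A\in\mathcal N$ and $\lambda^*\in\operatorname{conv}(\{\lambda_x : x\in A\})$ such that the restriction of the function $x\mapsto J(x)-\mu\varphi(\Psi(x,\lambda^*))$ to $A$ has at least two global minima. -/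

import Mathlib

open Set Topology

/-- A filtering cover of `X`: a family of non-empty subsets covering `X` and upward directed in the
sense that the union of any two members is contained in a member. -/
structure IsFilteringCover {X : Type*} (𝒩 : Set (Set X)) : Prop where
  nonempty_of_mem : ∀ A ∈ 𝒩, A.Nonempty
  sUnion_eq : ⋃₀ 𝒩 = univ
  directed : ∀ A₁ ∈ 𝒩, ∀ A₂ ∈ 𝒩, ∃ A₃ ∈ 𝒩, A₁ ∪ A₂ ⊆ A₃

/-- A real function on a topological space is inf-compact if all its sublevel sets are compact. -/
def InfCompact {U : Type*} [TopologicalSpace U] (ψ : U → ℝ) : Prop :=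
  ∀ r : ℝ, IsCompact {x : U | ψ x ≤ r}

/-- The class `𝒢` of lower semicontinuous functions `φ : Y → [0, +∞[` vanishing exactly at `y₀`
and whose infimum outside each neighbourhood of `y₀` is positive (with `inf ∅ = +∞`). -/
structure MemClassG {Y : Type*} [TopologicalSpace Y] (y₀ : Y) (φ : Y → ℝ) : Prop where
  lsc : LowerSemicontinuous φ
  nonneg : ∀ y, 0 ≤ φ y
  eq_zero_iff : ∀ y, φ y = 0 ↔ y = y₀
  pos_off_nhds : ∀ V ∈ 𝓝 y₀, ∃ c : ℝ, 0 < c ∧ ∀ y ∉ V, c ≤ φ y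

/-- The class `ℋ` of functions `Ψ : X × Λ → Y` (curried) such that each `Ψ(x, ·)` is continuous,
injective, open and takes the value `y₀` at a (unique) point, and such that this point is not the
same for all `x`. -/
structure MemClassH {X Λ Y : Type*} [TopologicalSpace Λ] [TopologicalSpace Y] (y₀ : Y)
    (Ψ : X → Λ → Y) : Prop where
  continuous : ∀ x, Continuous (Ψ x)
  injective : ∀ x, Function.Injective (Ψ x)
  isOpenMap : ∀ x, IsOpenMap (Ψ x)
  exists_eq : ∀ x, ∃ l : Λ, Ψ x l = y₀
  not_constant : ∃ (x₁ x₂ : X) (l₁ l₂ : Λ), Ψ x₁ l₁ = y₀ ∧ Ψ x₂ l₂ = y₀ ∧ l₁ ≠ l₂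

/-- The point `λ_x`, that is, the unique `l : Λ` with `Ψ(x, l) = y₀`. -/
noncomputable def MemClassH.pt {X Λ Y : Type*} [TopologicalSpace Λ] [TopologicalSpace Y] {y₀ : Y}
    {Ψ : X → Λ → Y} (hΨ : MemClassH y₀ Ψ) (x : X) : Λ :=
  (hΨ.exists_eq x).choose

theorem MemClassH.apply_eq_iff {X Λ Y : Type*} [TopologicalSpace Λ] [TopologicalSpace Y] {y₀ : Y}
    {Ψ : X → Λ → Y} (hΨ : MemClassH y₀ Ψ) (x : X) (l : Λ) : Ψ x l = y₀ ↔ l = hΨ.pt x := by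
  have h : Ψ x (hΨ.pt x) = y₀ := (hΨ.exists_eq x).choose_spec
  constructor
  · intro hl
    exact hΨ.injective x (hl.trans h.symm)
  · rintro rfl
    exact h

/-- The set `M_J` of all global minima of `J`. -/
def globalMinima {X : Type*} (J : X → ℝ) : Set X :=
  {u | ∀ x, J u ≤ J x}

/-- The set of quotients whose infimum is `θ(φ, Ψ, J)`. -/
def thetaSet {X Λ Y : Type*} [TopologicalSpace Λ] [TopologicalSpace Y] {y₀ : Y}
    (φ : Y → ℝ) {Ψ : X → Λ → Y} (hΨ : MemClassH y₀ Ψ) (J : X → ℝ) : Set ℝ :=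
  {t | ∃ u ∈ globalMinima J, ∃ x : X,
    hΨ.pt x ≠ hΨ.pt u ∧ t = (J x - J u) / φ (Ψ x (hΨ.pt u))}

theorem thetaSet_nonempty {X Λ Y : Type*} [TopologicalSpace Λ] [TopologicalSpace Y] {y₀ : Y}
    (φ : Y → ℝ) {Ψ : X → Λ → Y} (hΨ : MemClassH y₀ Ψ) {J : X → ℝ}
    (hJ : (globalMinima J).Nonempty) : (thetaSet φ hΨ J).Nonempty := by
  obtain ⟨u, hu⟩ := hJ
  obtain ⟨x₁, x₂, l₁, l₂, h₁, h₂, hne⟩ := hΨ.not_constant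
  rw [hΨ.apply_eq_iff] at h₁ h₂
  subst h₁ h₂
  by_cases h : hΨ.pt x₁ = hΨ.pt u
  · exact ⟨_, u, hu, x₂, fun h' => hne (h.trans h'.symm), rfl⟩
  · exact ⟨_, u, hu, x₁, h, rfl⟩

theorem thetaSet_bddBelow {X Λ Y : Type*} [TopologicalSpace Λ] [TopologicalSpace Y] {y₀ : Y}
    {φ : Y → ℝ} (hφ : MemClassG y₀ φ) {Ψ : X → Λ → Y} (hΨ : MemClassH y₀ Ψ) (J : X → ℝ) :
    BddBelow (thetaSet φ hΨ J) := by
  refine ⟨0, ?_⟩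
  rintro t ⟨u, hu, x, -, rfl⟩
  exact div_nonneg (sub_nonneg.2 (hu x)) (hφ.nonneg _)

/-- The number `θ(φ, Ψ, J)`. For `φ ∈ 𝒢`, `Ψ ∈ ℋ` and `J` with a global minimum this is the infimum
of a non-empty set of reals bounded below by `0`, all the denominators being positive. -/
noncomputable def theta {X Λ Y : Type*} [TopologicalSpace Λ] [TopologicalSpace Y] {y₀ : Y}
    (φ : Y → ℝ) {Ψ : X → Λ → Y} (hΨ : MemClassH y₀ Ψ) (J : X → ℝ) : ℝ :=
  sInf (thetaSet φ hΨ J)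

/-! Write `P x l = φ (Ψ x l)` and `f x l = J x - μ * P x l`, which is concave and upper
semicontinuous in `l`. On a finitely generated polytope let `l` maximize `inf_x f x l`, and let
`a` minimize `f · l`. Comparing `l` with the points of a short segment issuing from it shows that,
if `a` is the only minimizer, `(a, l)` is a saddle point. Hence, if `f · l` never had two global
minima, compactness of the sublevel sets would give: whenever `inf_x f x l ≤ r` for all `l`, a
single `x` satisfies `f x l ≤ r` for all `l`. Taking `l = λ_x` yields `J x ≤ r`. But `μ > θ`
provides `u ∈ M_J` and `v` such that `min (f u l) (f v l)` stays below some `r < J u = min J`: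
near `λ_u` because `f v λ_u < J u`, and away from `λ_u` because `P u` is bounded away from zero
there. -/

theorem InfCompact.globalMinima_nonempty {Z : Type*} [TopologicalSpace Z] [Nonempty Z] {ψ : Z → ℝ}
    (hcomp : InfCompact ψ) (hlsc : LowerSemicontinuous ψ) : (globalMinima ψ).Nonempty := by
  obtain ⟨z₀⟩ := ‹Nonempty Z›
  obtain ⟨x, hx, hmin⟩ := LowerSemicontinuousOn.exists_isMinOn (s := {z | ψ z ≤ ψ z₀})
    ⟨z₀, le_refl (ψ z₀)⟩ (hcomp _) (hlsc.lowerSemicontinuousOn _)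
  refine ⟨x, fun z => ?_⟩
  obtain hz | hz := le_total (ψ z) (ψ z₀)
  · exact hmin hz
  · exact le_trans hx hz

section Minimax

variable {Z Λ : Type*} {f : Z → Λ → ℝ} {S : Set Λ}

/-- `(a, l)` is a maximin pair of `f` over `S`: `a` is a global minimum of `f · l`, and `l`
maximizes the lower envelope `m ↦ inf_x f x m` over `S`. The envelope is only evaluated where it is
attained, so that no infimum of an unbounded set of reals occurs. -/
structure IsMaximinPair (f : Z → Λ → ℝ) (S : Set Λ) (a : Z) (l : Λ) : Prop where
  mem : l ∈ S
  isMin : a ∈ globalMinima (f · l)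
  le_of_isMin : ∀ m ∈ S, ∀ b ∈ globalMinima (f · m), f b m ≤ f a l

theorem exists_isMaximinPair [TopologicalSpace Λ] (hS : IsCompact S) (hne : S.Nonempty)
    (husc : ∀ x, UpperSemicontinuousOn (f x) S)
    (hmin : ∀ l ∈ S, (globalMinima (f · l)).Nonempty) : ∃ a l, IsMaximinPair f S a l := by
  have : Nonempty Z := (hmin _ hne.some_mem).to_type
  choose! a ha using hmin
  have henv : UpperSemicontinuousOn (fun l => f (a l) l) S := by
    intro l hl c hc
    filter_upwards [husc (a l) l hl c hc, self_mem_nhdsWithin] with m hm hmS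
    exact (ha m hmS _).trans_lt hm
  obtain ⟨l, hl, hmax⟩ := henv.exists_isMaxOn hne hS
  exact ⟨a l, l, hl, ha l hl, fun m hm b hb => (hb _).trans (hmax hm)⟩

variable [AddCommGroup Λ] [Module ℝ Λ]

theorem IsMaximinPair.exists_le_and_combo_le {a b : Z} {l m : Λ} (h : IsMaximinPair f S a l)
    (hconc : ∀ x, ConcaveOn ℝ S (f x)) (hmin : ∀ p ∈ S, (globalMinima (f · p)).Nonempty)
    (hm : m ∈ S) (hb : b ∈ globalMinima (f · m)) {t : ℝ} (ht : t ∈ Ioo (0 : ℝ) 1) :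
    ∃ x, f x m ≤ f a l ∧ (1 - t) * f x l + t * f b m ≤ f a l := by
  obtain ⟨ht0, ht1⟩ := ht
  have ht' : 0 < 1 - t := sub_pos.2 ht1
  have hp : (1 - t) • l + t • m ∈ S := (hconc a).1 h.mem hm ht'.le ht0.le (by ring)
  obtain ⟨x, hx⟩ := hmin _ hp
  have hchord : (1 - t) * f x l + t * f x m ≤ f a l :=
    ((hconc x).2 h.mem hm ht'.le ht0.le (by ring)).trans (h.le_of_isMin _ hp x hx)
  have hal : (1 - t) * f a l ≤ (1 - t) * f x l := mul_le_mul_of_nonneg_left (h.isMin x) ht'.le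
  have hbm : t * f b m ≤ t * f x m := mul_le_mul_of_nonneg_left (hb x) ht0.le
  exact ⟨x, le_of_mul_le_mul_left (by linarith) ht0, by linarith⟩

theorem le_of_forall_combo_le {a b c : ℝ} (h : ∀ t ∈ Ioo (0 : ℝ) 1, (1 - t) * a + t * b ≤ c) :
    a ≤ c := by
  have hlim : Filter.Tendsto (fun t : ℝ => (1 - t) * a + t * b) (𝓝[>] 0) (𝓝 a) :=
    (Continuous.tendsto' (by fun_prop) 0 a (by simp)).mono_left nhdsWithin_le_nhds
  exact le_of_tendsto hlim (Filter.mem_of_superset (Ioo_mem_nhdsGT one_pos) h)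

theorem IsMaximinPair.isMaxOn [TopologicalSpace Z] {a : Z} {l : Λ} (h : IsMaximinPair f S a l)
    (hcomp : ∀ m ∈ S, LowerSemicontinuous (f · m) ∧ InfCompact (f · m))
    (hconc : ∀ x, ConcaveOn ℝ S (f x)) (huniq : (globalMinima (f · l)).Subsingleton) :
    IsMaxOn (f a) S l := by
  have : Nonempty Z := ⟨a⟩
  have hmin : ∀ m ∈ S, (globalMinima (f · m)).Nonempty := fun m hm =>
    (hcomp m hm).2.globalMinima_nonempty (hcomp m hm).1
  intro m hm
  obtain ⟨b, hb⟩ := hmin m hm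
  have hsegment {t : ℝ} (ht : t ∈ Ioo (0 : ℝ) 1) :=
    h.exists_le_and_combo_le hconc hmin hm hb ht
  obtain ⟨z, hz, -⟩ := hsegment (t := 1 / 2) (by norm_num)
  obtain ⟨x, hx, hxmin⟩ := LowerSemicontinuousOn.exists_isMinOn (s := {z | f z m ≤ f a l})
    ⟨z, hz⟩ ((hcomp m hm).2 _) ((hcomp l h.mem).1.lowerSemicontinuousOn _)
  have hxl : f x l ≤ f a l := le_of_forall_combo_le (b := f b m) fun t ht => by
    obtain ⟨w, hw, hwt⟩ := hsegment ht
    have : (1 - t) * f x l ≤ (1 - t) * f w l :=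
      mul_le_mul_of_nonneg_left (hxmin hw) (sub_nonneg.2 ht.2.le)
    linarith
  have hxa : x = a := huniq (fun z => hxl.trans (h.isMin z)) h.isMin
  exact hxa ▸ hx

variable [TopologicalSpace Z] [TopologicalSpace Λ] [IsTopologicalAddGroup Λ] [ContinuousSMul ℝ Λ]
  {C : Set Λ}

theorem exists_forall_mem_le_of_finite
    (hcomp : ∀ l ∈ C, LowerSemicontinuous (f · l) ∧ InfCompact (f · l))
    (hconc : ∀ x, ConcaveOn ℝ C (f x)) (husc : ∀ x, UpperSemicontinuousOn (f x) C)
    (huniq : ∀ l ∈ C, (globalMinima (f · l)).Subsingleton)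
    {r : ℝ} (hr : ∀ l ∈ C, ∃ x, f x l ≤ r)
    {F : Set Λ} (hF : F.Finite) (hne : F.Nonempty) (hFC : F ⊆ C) : ∃ x, ∀ l ∈ F, f x l ≤ r := by
  obtain ⟨z, -⟩ := hr _ (hFC hne.some_mem)
  have : Nonempty Z := ⟨z⟩
  have hSC : convexHull ℝ F ⊆ C := convexHull_min hFC (hconc z).1
  obtain ⟨a, l, h⟩ := exists_isMaximinPair (hF.isCompact_convexHull ℝ) hne.convexHull
    (fun x => (husc x).mono hSC)
    (fun l hl => (hcomp l (hSC hl)).2.globalMinima_nonempty (hcomp l (hSC hl)).1)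
  have hsaddle : IsMaxOn (f a) (convexHull ℝ F) l :=
    h.isMaxOn (fun l hl => hcomp l (hSC hl))
      (fun x => (hconc x).subset hSC (convex_convexHull ℝ F)) (huniq l (hSC h.mem))
  obtain ⟨x, hx⟩ := hr l (hSC h.mem)
  exact ⟨a, fun m hm => (hsaddle (subset_convexHull ℝ F hm)).trans ((h.isMin x).trans hx)⟩

theorem exists_forall_mem_le_of_subsingleton_globalMinima (hne : C.Nonempty)
    (hcomp : ∀ l ∈ C, LowerSemicontinuous (f · l) ∧ InfCompact (f · l))
    (hconc : ∀ x, ConcaveOn ℝ C (f x)) (husc : ∀ x, UpperSemicontinuousOn (f x) C)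
    (huniq : ∀ l ∈ C, (globalMinima (f · l)).Subsingleton)
    {r : ℝ} (hr : ∀ l ∈ C, ∃ x, f x l ≤ r) : ∃ x, ∀ l ∈ C, f x l ≤ r := by
  obtain ⟨l₀, hl₀⟩ := hne
  have hfip : ({x | f x l₀ ≤ r} ∩ ⋂ l : C, {x | f x l ≤ r}).Nonempty := by
    refine ((hcomp l₀ hl₀).2 r).inter_iInter_nonempty _
      (fun l => (hcomp l l.2).1.isClosed_preimage r) fun u => ?_
    obtain ⟨x, hx⟩ := exists_forall_mem_le_of_finite hcomp hconc husc huniq hr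
      (F := insert l₀ ((↑) '' (u : Set C))) ((u.finite_toSet.image _).insert _)
      (insert_nonempty _ _) (insert_subset hl₀ (Subtype.coe_image_subset C u))
    exact ⟨x, hx l₀ (mem_insert _ _),
      mem_iInter₂.2 fun m hm => hx m (mem_insert_of_mem _ (mem_image_of_mem _ hm))⟩
  obtain ⟨x, -, hx⟩ := hfip
  exact ⟨x, fun l hl => mem_iInter.1 hx ⟨l, hl⟩⟩

end Minimax

theorem upperSemicontinuous_const_sub_mul {Λ : Type*} [TopologicalSpace Λ] {P : Λ → ℝ}
    (hP : LowerSemicontinuous P) (c : ℝ) {μ : ℝ} (hμ : 0 ≤ μ) :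
    UpperSemicontinuous fun l => c - μ * P l :=
  Continuous.comp_lowerSemicontinuous_antitone (g := fun s => c - μ * s) (by fun_prop) hP
    fun _ _ hst => sub_le_sub_left (mul_le_mul_of_nonneg_left hst hμ) c

theorem MemClassG.exists_lt_forall_le_or_le {Λ : Type*} [TopologicalSpace Λ] {q : Λ}
    {P Q : Λ → ℝ} (hP : MemClassG q P) (hQ : LowerSemicontinuous Q) {a b μ : ℝ} (hμ : 0 < μ)
    (hab : b - μ * Q q < a) : ∃ r < a, ∀ l, a - μ * P l ≤ r ∨ b - μ * Q l ≤ r := by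
  obtain ⟨s, hs, hsa⟩ := exists_between hab
  obtain ⟨c, hc, hcP⟩ :=
    hP.pos_off_nhds _ (upperSemicontinuous_const_sub_mul hQ b hμ.le q s hs)
  refine ⟨max s (a - μ * c), max_lt hsa (sub_lt_self a (mul_pos hμ hc)), fun l => ?_⟩
  obtain hl | hl := lt_or_ge (b - μ * Q l) s
  · exact .inr (hl.le.trans (le_max_left _ _))
  · have hcl : c ≤ P l := hcP l hl.not_gt
    exact .inl (le_max_of_le_right (by gcongr))

theorem IsFilteringCover.exists_mem_mem {X : Type*} {𝒩 : Set (Set X)} (h𝒩 : IsFilteringCover 𝒩)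
    (x y : X) : ∃ A ∈ 𝒩, x ∈ A ∧ y ∈ A := by
  obtain ⟨A₁, hA₁, hx⟩ : ∃ A ∈ 𝒩, x ∈ A := mem_sUnion.1 (h𝒩.sUnion_eq ▸ mem_univ x)
  obtain ⟨A₂, hA₂, hy⟩ : ∃ A ∈ 𝒩, y ∈ A := mem_sUnion.1 (h𝒩.sUnion_eq ▸ mem_univ y)
  obtain ⟨A, hA, hsub⟩ := h𝒩.directed A₁ hA₁ A₂ hA₂
  exact ⟨A, hA, hsub (.inl hx), hsub (.inr hy)⟩

section Penalty

variable {X Λ : Type*} [TopologicalSpace X] [AddCommGroup Λ] [Module ℝ Λ] [TopologicalSpace Λ]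
  [IsTopologicalAddGroup Λ] [ContinuousSMul ℝ Λ] {p : X → Λ} {P : X → Λ → ℝ} {J : X → ℝ} {μ : ℝ}

theorem exists_nontrivial_globalMinima_sub_mul (hP : ∀ x, MemClassG (p x) (P x))
    (hconv : ∀ x, ConvexOn ℝ univ (P x)) {u v : X} (hu : u ∈ globalMinima J)
    (huv : J v - μ * P v (p u) < J u)
    (hcomp : ∀ l ∈ convexHull ℝ (range p),
      LowerSemicontinuous (fun x => J x - μ * P x l) ∧ InfCompact (fun x => J x - μ * P x l)) :
    ∃ l ∈ convexHull ℝ (range p), (globalMinima fun x => J x - μ * P x l).Nontrivial := by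
  have hμ : 0 < μ := pos_of_mul_pos_left (by linarith [hu v]) ((hP v).nonneg (p u))
  obtain ⟨r, hr, hle⟩ := (hP u).exists_lt_forall_le_or_le (hP v).lsc hμ huv
  have : Nonempty X := ⟨u⟩
  by_contra! huniq
  obtain ⟨x, hx⟩ := exists_forall_mem_le_of_subsingleton_globalMinima
    ((range_nonempty p).convexHull) hcomp
    (fun x => ((concaveOn_const (J x) convex_univ).sub ((hconv x).smul hμ.le)).subset
      (subset_univ _) (convex_convexHull ℝ _))
    (fun x => (upperSemicontinuous_const_sub_mul (hP x).lsc (J x) hμ.le).upperSemicontinuousOn _)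
    huniq fun l _ => (hle l).elim (⟨u, ·⟩) (⟨v, ·⟩)
  have hJx : J x ≤ r := by
    simpa [((hP x).eq_zero_iff _).2 rfl] using hx (p x) (subset_convexHull ℝ _ (mem_range_self x))
  exact (hu x).not_gt (hJx.trans_lt hr)

/-- The hypothesis `hθ` is the condition `μ > θ` cleared of its denominator. -/
theorem theorem3p3_general (hP : ∀ x, MemClassG (p x) (P x))
    (hconv : ∀ x, ConvexOn ℝ univ (P x))
    (hθ : ∃ u ∈ globalMinima J, ∃ v, J v - μ * P v (p u) < J u)
    {𝒩 : Set (Set X)} (h𝒩 : IsFilteringCover 𝒩)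
    (hcomp : ∀ A ∈ 𝒩, ∀ l ∈ convexHull ℝ (p '' A),
      LowerSemicontinuous (fun x : A => J x - μ * P x l) ∧
        InfCompact (fun x : A => J x - μ * P x l)) :
    ∃ A ∈ 𝒩, ∃ l ∈ convexHull ℝ (p '' A), ∃ x₁ ∈ A, ∃ x₂ ∈ A, x₁ ≠ x₂ ∧
      IsMinOn (fun x => J x - μ * P x l) A x₁ ∧ IsMinOn (fun x => J x - μ * P x l) A x₂ := by
  obtain ⟨u, hu, v, huv⟩ := hθ
  obtain ⟨A, hA, huA, hvA⟩ := h𝒩.exists_mem_mem u v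
  have hrange : range (fun x : A => p x) = p '' A := (image_eq_range p A).symm
  obtain ⟨l, hl, x₁, hx₁, x₂, hx₂, hne⟩ :=
    exists_nontrivial_globalMinima_sub_mul (X := A) (J := fun x => J x) (fun x => hP x)
      (fun x => hconv x) (u := ⟨u, huA⟩) (v := ⟨v, hvA⟩) (fun x => hu x) huv
      (hrange ▸ hcomp A hA)
  exact ⟨A, hA, l, hrange ▸ hl, x₁, x₁.2, x₂, x₂.2, Subtype.coe_ne_coe.2 hne,
    fun z hz => hx₁ ⟨z, hz⟩, fun z hz => hx₂ ⟨z, hz⟩⟩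

end Penalty

section Classes

variable {X Λ Y : Type*} [TopologicalSpace Λ] [TopologicalSpace Y] {y₀ : Y} {φ : Y → ℝ}
  {Ψ : X → Λ → Y}

theorem MemClassH.apply_pt (hΨ : MemClassH y₀ Ψ) (x : X) : Ψ x (hΨ.pt x) = y₀ :=
  (hΨ.apply_eq_iff x _).2 rfl

theorem MemClassG.comp_memClassH (hφ : MemClassG y₀ φ) (hΨ : MemClassH y₀ Ψ) (x : X) :
    MemClassG (hΨ.pt x) fun l => φ (Ψ x l) where
  lsc := hφ.lsc.comp (hΨ.continuous x)
  nonneg _ := hφ.nonneg _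
  eq_zero_iff l := (hφ.eq_zero_iff _).trans (hΨ.apply_eq_iff x l)
  pos_off_nhds V hV := by
    have hV' : Ψ x '' V ∈ 𝓝 y₀ := hΨ.apply_pt x ▸ (hΨ.isOpenMap x).image_mem_nhds hV
    obtain ⟨c, hc, hcV⟩ := hφ.pos_off_nhds _ hV'
    exact ⟨c, hc, fun l hl => hcV _ fun h => hl ((hΨ.injective x).mem_set_image.1 h)⟩

theorem exists_sub_mul_lt_of_theta_lt (hφ : MemClassG y₀ φ) (hΨ : MemClassH y₀ Ψ) {J : X → ℝ}
    (hJ : (globalMinima J).Nonempty) {μ : ℝ} (hμ : theta φ hΨ J < μ) :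
    ∃ u ∈ globalMinima J, ∃ v, J v - μ * φ (Ψ v (hΨ.pt u)) < J u := by
  obtain ⟨_, ⟨u, hu, v, hne, rfl⟩, hlt⟩ := exists_lt_of_csInf_lt (thetaSet_nonempty φ hΨ hJ) hμ
  have hP := hφ.comp_memClassH hΨ v
  have hpos : 0 < φ (Ψ v (hΨ.pt u)) :=
    (hP.nonneg _).lt_of_ne' fun h => hne ((hP.eq_zero_iff _).1 h).symm
  rw [div_lt_iff₀ hpos] at hlt
  exact ⟨u, hu, v, by linarith⟩

end Classes

theorem theorem3p3 {X Λ Y : Type*} [TopologicalSpace X] [AddCommGroup Λ] [Module ℝ Λ]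
    [TopologicalSpace Λ] [IsTopologicalAddGroup Λ] [ContinuousSMul ℝ Λ] [T2Space Λ]
    [TopologicalSpace Y] (y₀ : Y) (φ : Y → ℝ) (hφ : MemClassG y₀ φ)
    (Ψ : X → Λ → Y) (hΨ : MemClassH y₀ Ψ)
    (J : X → ℝ) (hJ : (globalMinima J).Nonempty)
    (hconv : ∀ x, ConvexOn ℝ univ (fun l => φ (Ψ x l)))
    (μ : ℝ) (hμ : theta φ hΨ J < μ)
    (𝒩 : Set (Set X)) (h𝒩 : IsFilteringCover 𝒩)
    (hlsc : ∀ A ∈ 𝒩, ∀ l ∈ convexHull ℝ (range hΨ.pt),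
      LowerSemicontinuous (fun x : A => J x - μ * φ (Ψ x l)) ∧
        InfCompact (fun x : A => J x - μ * φ (Ψ x l))) :
    ∃ A ∈ 𝒩, ∃ l ∈ convexHull ℝ (hΨ.pt '' A), ∃ x₁ ∈ A, ∃ x₂ ∈ A, x₁ ≠ x₂ ∧
      IsMinOn (fun x => J x - μ * φ (Ψ x l)) A x₁ ∧
      IsMinOn (fun x => J x - μ * φ (Ψ x l)) A x₂ :=
  theorem3p3_general (fun x => hφ.comp_memClassH hΨ x) hconv
    (exists_sub_mul_lt_of_theta_lt hφ hΨ hJ hμ) h𝒩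
    fun A hA l hl => hlsc A hA l (convexHull_mono (image_subset_range _ _) hl)
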